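/- For a positive integer $n$ let $$F_n(x) = 1 + x + \frac{x^2}{2} + \cdots + \frac{x^n}{n} \in \mathbf{Q}[x],$$ and let $\operatorname{disc}(F_n) = (-1)^{\binom{n}{2}} a_n^{-1} \operatorname{Res}(F_n, F_n')$ be its discriminant, where $a_n = 1/n$ is the leading coefficient of $F_n$. For every prime number $q$, if $n = 3q$, $5q$ or $7q$, then $\operatorname{disc}(F_n)$ is not the square of a rational number. -/

import Mathlib

/-- The truncated logarithmic polynomial `F_n(x) = 1 + x + x^2/2 + ⋯ + x^n/n` over the rationals:
the truncation at degree `n` of the Maclaurin series of `1 - log (1 - x)`. -/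
noncomputable def truncatedLogPoly (n : ℕ) : Polynomial ℚ :=
  1 + ∑ k ∈ Finset.Icc 1 n, Polynomial.C (1 / (k : ℚ)) * Polynomial.X ^ k

/-!
Let `L` be a common multiple of `1, …, n` and `R` the resultant of `L * F_n` and
`F_n' = 1 + X + ⋯ + X ^ (n - 1)`, so that `L ^ (n - 1) * disc F_n = ± n * R`. Modulo a prime `ℓ`
whose exact power in `L` is `ℓ ^ m`, only the terms of `L * F_n` whose exponent is divisible by
`ℓ ^ m` survive. If the leading digit of `n` in base `ℓ` is `1`, one term is left and `R` is a unit
modulo `ℓ`. For even `n`, a prime `ℓ` from Bertrand's postulate then divides the discriminant to an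
odd power; for `n` congruent to `3` modulo `4`, the prime `2` gives `R ≠ 0`, and the discriminant is
negative.

For odd `n = p * q` with `q` a prime greater than `p`, the valuation of `n * R` at `q` is odd unless
`q ∣ R`, which forces `w + w ^ 2 / 2 + ⋯ + w ^ p / p` to vanish at some `p`-th root of unity `w` in
characteristic `q`. For `p = 3, 5, 7` a Bézout identity leaves finitely many such `q`; these, and
`q ≤ p`, are settled by the sign of the discriminant or by its class modulo squares at an auxiliary
prime.
-/

open Polynomial Finset
open scoped Nat NumberTheorySymbols

section GeometricSum

variable {R : Type*} [CommRing R]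

lemma coeff_geom_sum_X (n k : ℕ) :
    (∑ i ∈ range n, (X : R[X]) ^ i).coeff k = if k < n then 1 else 0 := by
  simp [finsetSum_coeff, coeff_X_pow]

lemma natDegree_geom_sum_X [Nontrivial R] (n : ℕ) :
    (∑ i ∈ range n, (X : R[X]) ^ i).natDegree = n - 1 := by
  rcases n with - | n
  · simp
  refine natDegree_eq_of_le_of_coeff_ne_zero (natDegree_sum_le_of_forall_le _ _ fun i hi ↦ ?_) ?_
  · exact (natDegree_X_pow_le i).trans (Nat.le_sub_one_of_lt (mem_range.1 hi))
  · simp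

lemma geom_sum_X_eq_prod [IsDomain R] {n : ℕ} {ζ : R} (hζ : IsPrimitiveRoot ζ (n + 1)) :
    ∑ i ∈ range (n + 1), (X : R[X]) ^ i = ∏ i ∈ range n, (X - C (ζ ^ (i + 1))) := by
  have h := X_pow_sub_C_eq_prod hζ n.succ_pos (one_pow (n + 1))
  simp only [mul_one] at h
  rw [C_1, ← geom_sum_mul, prod_range_succ', pow_zero, C_1] at h
  exact mul_right_cancel₀ (by simpa using X_sub_C_ne_zero (1 : R)) h

lemma resultant_geom_sum_X_eq_prod [IsDomain R] {m n : ℕ} {ζ : R}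
    (hζ : IsPrimitiveRoot ζ (n + 1)) {f : R[X]} (hf : f.natDegree ≤ m) :
    f.resultant (∑ i ∈ range (n + 1), X ^ i) m n =
      (-1) ^ (m * n) * ∏ i ∈ range n, f.eval (ζ ^ (i + 1)) := by
  have h := resultant_prod_right (range n) f (fun i ↦ X - C (ζ ^ (i + 1))) m hf
    (by simp only [leadingCoeff_X_sub_C, prod_const_one, ne_eq, one_ne_zero, not_false_eq_true])
  rw [← geom_sum_X_eq_prod hζ, natDegree_geom_sum_X, Nat.add_sub_cancel] at h
  simp only [h, natDegree_X_sub_C, resultant_X_sub_C_right f m _ hf, prod_mul_distrib, prod_const,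
    card_range, pow_mul]

lemma resultant_X_pow_geom_sum_X {a n : ℕ} (ha : a ≤ n) (hn : n ≠ 0) :
    (X ^ a : R[X]).resultant (∑ i ∈ range n, X ^ i) n (n - 1) = (-1) ^ ((n - 1) * (n - a)) := by
  nontriviality R
  obtain ⟨k, rfl⟩ := Nat.exists_eq_add_of_le ha
  rw [resultant_add_left_deg _ _ _ _ _ (natDegree_X_pow_le a),
    resultant_X_pow_left _ _ _ (natDegree_geom_sum_X _).le, coeff_geom_sum_X, coeff_geom_sum_X,
    if_pos (by lia), if_pos (by lia), Nat.add_sub_cancel_left]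
  simp [mul_comm]

/-- Complex conjugation pairs the factors `f(ζ)` and `f(ζ⁻¹)` of the resultant. -/
lemma resultant_geom_sum_X_nonneg {m n : ℕ} (hn : Odd n) {f : ℝ[X]} (hf : f.natDegree ≤ m) :
    0 ≤ f.resultant (∑ i ∈ range n, X ^ i) m (n - 1) := by
  obtain ⟨k, rfl⟩ := hn
  obtain ⟨ζ, hζ⟩ : ∃ ζ : ℂ, IsPrimitiveRoot ζ (2 * k + 1) :=
    ⟨_, Complex.isPrimitiveRoot_exp _ (by lia)⟩
  set F : ℂ[X] := f.map (algebraMap ℝ ℂ) with hF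
  have eval_conj (z : ℂ) : F.eval (starRingEnd ℂ z) = starRingEnd ℂ (F.eval z) := by
    rw [hF, eval_map_algebraMap, eval_map_algebraMap]
    exact aeval_conj f z
  have conj_pow_reflect {i : ℕ} (hi : i < k) :
      ζ ^ (k + (k - 1 - i) + 1) = starRingEnd ℂ (ζ ^ (i + 1)) := by
    rw [map_pow, ← Complex.inv_eq_conj (hζ.norm'_eq_one (by lia)), inv_pow]
    refine eq_inv_of_mul_eq_one_left ?_
    rw [← pow_add, ← hζ.pow_eq_one]
    congr 1
    lia
  have resultant_eq : ((f.resultant (∑ i ∈ range (2 * k + 1), X ^ i) m (2 * k) : ℝ) : ℂ) =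
      (Complex.normSq (∏ i ∈ range k, F.eval (ζ ^ (i + 1))) : ℝ) := by
    calc ((f.resultant (∑ i ∈ range (2 * k + 1), X ^ i) m (2 * k) : ℝ) : ℂ)
        = F.resultant (∑ i ∈ range (2 * k + 1), X ^ i) m (2 * k) := by
          rw [← Complex.coe_algebraMap, ← resultant_map_map, Polynomial.map_sum]
          congr 1
          exact sum_congr rfl fun i _ ↦ by rw [Polynomial.map_pow, Polynomial.map_X]
      _ = ∏ i ∈ range (k + k), F.eval (ζ ^ (i + 1)) := by
          rw [resultant_geom_sum_X_eq_prod hζ (natDegree_map_le.trans hf),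
            ((even_two_mul k).mul_left m).neg_one_pow, one_mul, two_mul]
      _ = _ := by
          rw [prod_range_add, ← Complex.mul_conj, map_prod,
            ← prod_range_reflect fun i ↦ F.eval (ζ ^ (k + i + 1))]
          congr 1
          refine prod_congr rfl fun i hi ↦ ?_
          rw [conj_pow_reflect (mem_range.1 hi), eval_conj]
  rw [Nat.add_sub_cancel, Complex.ofReal_injective resultant_eq]
  exact Complex.normSq_nonneg _

end GeometricSum

lemma exists_common_root_of_resultant_eq_zero {R : Type*} [CommRing R] [IsDomain R]
    {f g : R[X]} {m : ℕ} (hf : f.natDegree ≤ m) (hg : g ≠ 0) (hs : g.Splits)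
    (h : f.resultant g m g.natDegree = 0) : ∃ z, f.IsRoot z ∧ g.IsRoot z := by
  rw [resultant_comm, resultant_eq_prod_eval g f m hf hs] at h
  have hprod : (g.roots.map fun z ↦ f.eval z).prod = 0 := by simpa [hg] using h
  obtain ⟨z, hz, hfz⟩ := Multiset.mem_map.1 (Multiset.prod_eq_zero_iff.1 hprod)
  exact ⟨z, hfz, isRoot_of_mem_roots hz⟩

section ScaledLog

variable (R : Type*) [CommRing R] (L n : ℕ)

/-- The polynomial `L * (X + X ^ 2 / 2 + ⋯ + X ^ n / n)` over an arbitrary commutative ring. The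
divisions `L / k` take place in `ℕ`, so `L` should be a common multiple of `1, …, n`. -/
noncomputable def scaledLogSum : R[X] :=
  ∑ k ∈ Icc 1 n, C ((L / k : ℕ) : R) * X ^ k

/-- The resultant of `L * F_n = L + scaledLogSum R L n` and `F_n' = 1 + X + ⋯ + X ^ (n - 1)`, in
formal degrees `n` and `n - 1` so that it is compatible with all ring homomorphisms. -/
noncomputable def scaledLogResultant : R :=
  (C (L : R) + scaledLogSum R L n).resultant (∑ i ∈ range n, X ^ i) n (n - 1)

lemma coeff_scaledLogSum (k : ℕ) :
    (scaledLogSum R L n).coeff k = if k ∈ Icc 1 n then ((L / k : ℕ) : R) else 0 := by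
  simp [scaledLogSum, finsetSum_coeff, coeff_X_pow]

lemma eval_scaledLogSum (z : R) :
    (scaledLogSum R L n).eval z = ∑ k ∈ Icc 1 n, ((L / k : ℕ) : R) * z ^ k := by
  simp [scaledLogSum, eval_finsetSum]

lemma natDegree_C_add_scaledLogSum_le (c : R) : (C c + scaledLogSum R L n).natDegree ≤ n := by
  refine natDegree_add_le_of_degree_le (by simp) (natDegree_sum_le_of_forall_le _ _ fun k hk ↦ ?_)
  exact (natDegree_C_mul_X_pow_le _ _).trans (mem_Icc.1 hk).2

lemma map_scaledLogResultant {S : Type*} [CommRing S] (f : R →+* S) :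
    f (scaledLogResultant R L n) = scaledLogResultant S L n := by
  rw [scaledLogResultant, scaledLogResultant, ← resultant_map_map]
  congr 1 <;> simp [scaledLogSum, Polynomial.map_sum]

variable {R L n}

lemma C_mul_scaledLogSum_comm {M : ℕ} (hL : ∀ k ∈ Icc 1 n, k ∣ L) (hM : ∀ k ∈ Icc 1 n, k ∣ M) :
    C (L : R) * scaledLogSum R M n = C (M : R) * scaledLogSum R L n := by
  ext k
  rw [coeff_C_mul, coeff_C_mul, coeff_scaledLogSum, coeff_scaledLogSum]
  split_ifs with hk
  · rw [← Nat.cast_mul, ← Nat.cast_mul, ← Nat.mul_div_assoc _ (hM k hk),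
      ← Nat.mul_div_assoc _ (hL k hk), mul_comm L M]
  · simp only [mul_zero]

/-- Modulo `ℓ` only the multiples of `ℓ ^ m` survive among the exponents, because `ℓ` divides
`ℓ ^ m * u / k` for every other `k`. -/
lemma scaledLogSum_pow_mul {ℓ m u : ℕ} [CharP R ℓ] (hℓ : ℓ.Prime)
    (hu : ∀ k ∈ Icc 1 n, k ∣ ℓ ^ m * u) :
    scaledLogSum R (ℓ ^ m * u) n = expand R (ℓ ^ m) (scaledLogSum R u (n / ℓ ^ m)) := by
  have hpos : 0 < ℓ ^ m := pow_pos hℓ.pos m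
  ext k
  rw [coeff_expand hpos, coeff_scaledLogSum, coeff_scaledLogSum]
  by_cases hk : ℓ ^ m ∣ k
  · obtain ⟨j, rfl⟩ := hk
    rw [if_pos (dvd_mul_right _ _), Nat.mul_div_cancel_left _ hpos, Nat.mul_div_mul_left _ _ hpos]
    congr 1
    simp only [mem_Icc, Nat.one_le_iff_ne_zero, Nat.le_div_iff_mul_le hpos, mul_comm j,
      mul_ne_zero_iff, hpos.ne', ne_eq, not_false_eq_true, true_and]
  · rw [if_neg hk, ite_eq_right_iff, CharP.cast_eq_zero_iff R ℓ]
    intro hkn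
    by_contra hndvd
    have hcop : (ℓ ^ m).Coprime (ℓ ^ m * u / k) := ((hℓ.coprime_iff_not_dvd).2 hndvd).pow_left m
    refine hk (hcop.dvd_of_dvd_mul_right ?_)
    rw [Nat.mul_div_cancel' (hu k hkn)]
    exact dvd_mul_right _ _

lemma exists_not_dvd_forall_dvd_pow_mul {ℓ m : ℕ} (hℓ : ℓ.Prime) (hn : n < ℓ ^ (m + 1)) :
    ∃ u, ¬ ℓ ∣ u ∧ ∀ k ∈ Icc 1 n, k ∣ ℓ ^ m * u := by
  refine ⟨ordCompl[ℓ] n !, Nat.not_dvd_ordCompl hℓ n.factorial_ne_zero, fun k hk ↦ ?_⟩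
  obtain ⟨hk1, hkn⟩ := mem_Icc.1 hk
  have hlog : k.factorization ℓ ≤ m := Nat.le_of_lt_succ <|
    (Nat.pow_lt_pow_iff_right hℓ.one_lt).1 ((Nat.ordProj_le ℓ (by lia)).trans_lt (by lia))
  rw [← Nat.ordProj_mul_ordCompl_eq_self k ℓ]
  exact mul_dvd_mul (pow_dvd_pow ℓ hlog)
    (Nat.ordCompl_dvd_ordCompl_of_dvd (Nat.dvd_factorial hk1 hkn) ℓ)

lemma scaledLogResultant_of_leading_digit_one {ℓ m u : ℕ} [CharP R ℓ] (hℓ : ℓ.Prime) (hm : m ≠ 0)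
    (hle : ℓ ^ m ≤ n) (hlt : n < 2 * ℓ ^ m) (hu : ∀ k ∈ Icc 1 n, k ∣ ℓ ^ m * u) :
    scaledLogResultant R (ℓ ^ m * u) n =
      (-1) ^ ((n - 1) * (n - ℓ ^ m)) * (u : R) ^ (n - 1) := by
  have hpos : 0 < ℓ ^ m := pow_pos hℓ.pos m
  have hdigit : n / ℓ ^ m = 1 := Nat.div_eq_of_lt_le (by lia) (by lia)
  have hzero : ((ℓ ^ m * u : ℕ) : R) = 0 := by
    rw [CharP.cast_eq_zero_iff R ℓ]
    exact dvd_mul_of_dvd_left (dvd_pow_self ℓ hm) u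
  have hsum : scaledLogSum R (ℓ ^ m * u) n = C (u : R) * X ^ ℓ ^ m := by
    rw [scaledLogSum_pow_mul hℓ hu, hdigit]
    simp [scaledLogSum]
  rw [scaledLogResultant, hzero, C_0, zero_add, hsum, resultant_C_mul_left,
    resultant_X_pow_geom_sum_X hle (by lia), mul_comm]

lemma exists_root_of_scaledLogResultant_eq_zero {K : Type*} [Field K] [IsAlgClosed K]
    (hn : n ≠ 0) (h : scaledLogResultant K L n = 0) :
    ∃ z : K, z ^ n = 1 ∧ L + (scaledLogSum K L n).eval z = 0 := by
  rw [scaledLogResultant, ← natDegree_geom_sum_X (R := K) n] at h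
  obtain ⟨z, hfz, hgz⟩ := exists_common_root_of_resultant_eq_zero
    (natDegree_C_add_scaledLogSum_le K L n _) (monic_geom_sum_X hn).ne_zero
    (IsAlgClosed.splits _) h
  refine ⟨z, ?_, by simpa using hfz⟩
  have hgeom : ∑ i ∈ range n, z ^ i = 0 := by simpa [IsRoot, eval_finsetSum] using hgz
  rw [← sub_eq_zero, ← geom_sum_mul, hgeom, zero_mul]

lemma exists_root_of_scaledLogResultant_mul_eq_zero {K : Type*} [Field K] [IsAlgClosed K]
    {p q u : ℕ} [CharP K q] (hq : q.Prime) (hpq : p * q ≠ 0)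
    (hu : ∀ k ∈ Icc 1 (p * q), k ∣ q ^ 1 * u) (h : scaledLogResultant K (q ^ 1 * u) (p * q) = 0) :
    ∃ w : K, w ^ p = 1 ∧ (scaledLogSum K u p).eval w = 0 := by
  obtain ⟨z, hz, hzsum⟩ := exists_root_of_scaledLogResultant_eq_zero hpq h
  refine ⟨z ^ q, by rw [← pow_mul, mul_comm, hz], ?_⟩
  rw [scaledLogSum_pow_mul hq hu, pow_one, expand_eval, Nat.mul_div_cancel _ hq.pos] at hzsum
  simpa using hzsum

lemma scaledLogResultant_nonneg (hn : Odd n) : 0 ≤ scaledLogResultant ℤ L n := by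
  rw [← Int.cast_nonneg_iff (R := ℝ), ← eq_intCast (Int.castRingHom ℝ), map_scaledLogResultant]
  exact resultant_geom_sum_X_nonneg hn (natDegree_C_add_scaledLogSum_le ℝ L n _)

end ScaledLog

section Discriminant

variable {L n : ℕ}

lemma C_mul_truncatedLogPoly (hL : ∀ k ∈ Icc 1 n, k ∣ L) :
    C (L : ℚ) * truncatedLogPoly n = C (L : ℚ) + scaledLogSum ℚ L n := by
  rw [truncatedLogPoly, scaledLogSum, mul_add, mul_one, mul_sum]
  congr 1
  refine sum_congr rfl fun k hk ↦ ?_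
  have hk0 : (k : ℚ) ≠ 0 := Nat.cast_ne_zero.2 (Nat.one_le_iff_ne_zero.1 (mem_Icc.1 hk).1)
  rw [← mul_assoc, ← C_mul, Nat.cast_div (hL k hk) hk0, mul_one_div]

lemma coeff_truncatedLogPoly_self (hn : n ≠ 0) : (truncatedLogPoly n).coeff n = (n : ℚ)⁻¹ := by
  simp [truncatedLogPoly, finsetSum_coeff, coeff_X_pow, coeff_one, hn, Nat.one_le_iff_ne_zero]

lemma natDegree_truncatedLogPoly (n : ℕ) : (truncatedLogPoly n).natDegree = n := by
  rcases eq_or_ne n 0 with rfl | hn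
  · simp [truncatedLogPoly]
  refine natDegree_eq_of_le_of_coeff_ne_zero (natDegree_add_le_of_degree_le (by simp)
    (natDegree_sum_le_of_forall_le _ _ fun k hk ↦ ?_)) ?_
  · exact (natDegree_C_mul_X_pow_le _ _).trans (mem_Icc.1 hk).2
  · rw [coeff_truncatedLogPoly_self hn]
    exact inv_ne_zero (Nat.cast_ne_zero.2 hn)

lemma derivative_truncatedLogPoly (n : ℕ) :
    derivative (truncatedLogPoly n) = ∑ i ∈ range n, X ^ i := by
  rw [truncatedLogPoly, derivative_add, derivative_one, zero_add, derivative_sum,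
    ← Ico_add_one_right_eq_Icc, sum_Ico_eq_sum_range, Nat.add_sub_cancel]
  refine sum_congr rfl fun i _ ↦ ?_
  have hi : ((1 + i : ℕ) : ℚ) ≠ 0 := Nat.cast_ne_zero.2 (by lia)
  rw [derivative_C_mul_X_pow, one_div_mul_cancel hi, C_1, one_mul, Nat.add_sub_cancel_left]

lemma pow_mul_discr_truncatedLogPoly (hn : n ≠ 0) (hL : ∀ k ∈ Icc 1 n, k ∣ L) :
    (L : ℚ) ^ (n - 1) * (truncatedLogPoly n).discr =
      (-1) ^ (n * (n - 1) / 2) * n * scaledLogResultant ℤ L n := by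
  have hdeg : 0 < (truncatedLogPoly n).degree := by
    rw [← natDegree_pos_iff_degree_pos, natDegree_truncatedLogPoly]
    exact Nat.pos_of_ne_zero hn
  have hdiscr := resultant_deriv hdeg
  rw [leadingCoeff, natDegree_truncatedLogPoly, coeff_truncatedLogPoly_self hn,
    derivative_truncatedLogPoly] at hdiscr
  have hsign : ((-1 : ℚ) ^ (n * (n - 1) / 2)) * (-1) ^ (n * (n - 1) / 2) = 1 := by
    rw [← mul_pow, neg_one_mul, neg_neg, one_pow]
  rw [← eq_intCast (Int.castRingHom ℚ), map_scaledLogResultant, scaledLogResultant,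
    ← C_mul_truncatedLogPoly hL, resultant_C_mul_left, hdiscr]
  have hn0 : (n : ℚ) ≠ 0 := Nat.cast_ne_zero.2 hn
  field_simp
  linear_combination -(L : ℚ) ^ (n - 1) * (truncatedLogPoly n).discr * hsign

lemma isSquare_of_isSquare_discr (hn : n ≠ 0) (hL : ∀ k ∈ Icc 1 n, k ∣ L)
    (hsq : IsSquare (truncatedLogPoly n).discr) :
    IsSquare ((-1) ^ (n * (n - 1) / 2) * (L : ℤ) ^ (n - 1) * (n * scaledLogResultant ℤ L n)) := by
  obtain ⟨s, hs⟩ := hsq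
  rw [← Rat.isSquare_intCast_iff]
  refine ⟨(L : ℚ) ^ (n - 1) * s, ?_⟩
  push_cast
  linear_combination (-(L : ℚ) ^ (n - 1)) * pow_mul_discr_truncatedLogPoly hn hL +
    ((L : ℚ) ^ (n - 1)) ^ 2 * hs

end Discriminant

section Criteria

variable {n ℓ : ℕ}

lemma isSquare_mul_scaledLogResultant {L : ℕ} (hn : n % 4 = 1) (hL : ∀ k ∈ Icc 1 n, k ∣ L)
    (hL0 : L ≠ 0) (hsq : IsSquare (truncatedLogPoly n).discr) (R : Type*) [CommRing R] :
    IsSquare (n * scaledLogResultant R L n) := by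
  obtain ⟨k, rfl⟩ : ∃ k, n = 4 * k + 1 := ⟨n / 4, by lia⟩
  have hsign : (4 * k + 1) * (4 * k + 1 - 1) / 2 = 2 * (k * (4 * k + 1)) := by
    rw [Nat.add_sub_cancel]
    exact Nat.div_eq_of_eq_mul_right two_pos (by ring)
  have h := isSquare_of_isSquare_discr (by lia) hL hsq
  rw [hsign, (even_two_mul _).neg_one_pow, one_mul, Nat.add_sub_cancel,
    ← Rat.isSquare_intCast_iff, Int.cast_mul] at h
  have hLk : IsSquare (((L : ℤ) ^ (4 * k) : ℤ) : ℚ) := by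
    rw [Rat.isSquare_intCast_iff]
    exact Even.isSquare_pow ⟨2 * k, by ring⟩ _
  have hint := h.div hLk
  rw [mul_div_cancel_left₀ _ (by positivity), Rat.isSquare_intCast_iff] at hint
  have hR := hint.map (Int.castRingHom R)
  rwa [map_mul, map_scaledLogResultant, map_natCast] at hR

lemma not_isSquare_discr_of_odd_valuation [Fact ℓ.Prime] {m u : ℕ} (hu : ¬ ℓ ∣ u)
    (hL : ∀ k ∈ Icc 1 n, k ∣ ℓ ^ m * u) (hR : scaledLogResultant (ZMod ℓ) (ℓ ^ m * u) n ≠ 0)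
    (hodd : Odd (m * (n - 1) + padicValNat ℓ n)) : ¬ IsSquare (truncatedLogPoly n).discr := by
  have hn : n ≠ 0 := by
    rintro rfl
    simp at hodd
  intro hsq
  have hℓ0 : ℓ ≠ 0 := (Fact.out : ℓ.Prime).ne_zero
  have hu0 : u ≠ 0 := fun h ↦ hu (h ▸ dvd_zero ℓ)
  set r := (scaledLogResultant ℤ (ℓ ^ m * u) n).natAbs with hr
  have hrℓ : ¬ ℓ ∣ r := by
    rwa [hr, ← Int.natCast_dvd, ← ZMod.intCast_zmod_eq_zero_iff_dvd,
      ← eq_intCast (Int.castRingHom (ZMod ℓ)), map_scaledLogResultant]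
  have hr0 : r ≠ 0 := fun h ↦ hrℓ (h ▸ dvd_zero ℓ)
  have hsq' : IsSquare ((ℓ ^ m * u) ^ (n - 1) * (n * r)) := by
    have h := (isSquare_of_isSquare_discr hn hL hsq).map Int.natAbsHom
    simpa [Int.natAbs_mul, Int.natAbs_pow] using h
  obtain ⟨s, hs⟩ := hsq'
  have hs0 : s ≠ 0 := by
    rintro rfl
    simp_all
  have hval := congrArg (padicValNat ℓ) hs
  rw [padicValNat.mul (by positivity) (by positivity), padicValNat.pow,
    padicValNat.mul (by positivity) hu0, padicValNat.mul hn hr0, padicValNat.prime_pow,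
    padicValNat.eq_zero_of_not_dvd hu, padicValNat.eq_zero_of_not_dvd hrℓ,
    padicValNat.mul hs0 hs0, add_zero, add_zero, mul_comm] at hval
  exact Nat.not_even_iff_odd.2 hodd ⟨_, hval⟩

theorem not_isSquare_discr_of_even (hn : Even n) (h2 : 2 < n) :
    ¬ IsSquare (truncatedLogPoly n).discr := by
  obtain ⟨k, rfl⟩ := hn
  obtain ⟨ℓ, hℓ, hkℓ, hℓk⟩ := Nat.exists_prime_lt_and_le_two_mul k (by lia)
  have hℓn : ℓ < k + k := by
    refine lt_of_le_of_ne (by lia) ?_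
    rintro rfl
    exact (Nat.not_prime_mul (show k ≠ 1 by lia) (show 2 ≠ 1 by lia)) (by rwa [mul_two])
  have : Fact ℓ.Prime := ⟨hℓ⟩
  obtain ⟨u, hu, hL⟩ := exists_not_dvd_forall_dvd_pow_mul (m := 1) (n := k + k) hℓ
    (by rw [one_add_one_eq_two]; nlinarith)
  refine not_isSquare_discr_of_odd_valuation hu hL ?_ ?_
  · rw [scaledLogResultant_of_leading_digit_one hℓ one_ne_zero (by lia) (by lia) hL]
    have hu0 : (u : ZMod ℓ) ≠ 0 := by rwa [ne_eq, ZMod.natCast_eq_zero_iff]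
    exact mul_ne_zero (by simp) (pow_ne_zero _ hu0)
  · have hndvd : ¬ ℓ ∣ k + k := by
      intro h
      have := Nat.eq_of_dvd_of_lt_two_mul (by lia) h (by lia)
      lia
    rw [padicValNat.eq_zero_of_not_dvd hndvd]
    exact ⟨k - 1, by lia⟩

/-- The discriminant is negative. -/
theorem not_isSquare_discr_of_mod_four_eq_three (hn : n % 4 = 3) :
    ¬ IsSquare (truncatedLogPoly n).discr := by
  intro hsq
  set m := Nat.log 2 n with hm
  have hm0 : m ≠ 0 := (Nat.log_pos one_lt_two (by lia)).ne'
  have hlt : n < 2 ^ (m + 1) := Nat.lt_pow_succ_log_self one_lt_two n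
  obtain ⟨u, hu, hL⟩ := exists_not_dvd_forall_dvd_pow_mul Nat.prime_two hlt
  have hu0 : 0 < u := Nat.pos_of_ne_zero fun h ↦ hu (h ▸ dvd_zero 2)
  have hR0 : scaledLogResultant ℤ (2 ^ m * u) n ≠ 0 := by
    intro h
    have hmod := scaledLogResultant_of_leading_digit_one (R := ZMod 2) Nat.prime_two hm0
      (Nat.pow_log_le_self 2 (by lia)) (by rwa [← pow_succ']) hL
    rw [← map_scaledLogResultant ℤ _ _ (Int.castRingHom (ZMod 2)), h, map_zero] at hmod
    have hu2 : (u : ZMod 2) ≠ 0 := by rwa [ne_eq, ZMod.natCast_eq_zero_iff]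
    exact mul_ne_zero (by simp) (pow_ne_zero _ hu2) hmod.symm
  have hR : 0 < scaledLogResultant ℤ (2 ^ m * u) n :=
    (scaledLogResultant_nonneg (Nat.odd_iff.2 (by lia))).lt_of_ne' hR0
  have hsign : Odd (n * (n - 1) / 2) := by
    obtain ⟨k, rfl⟩ : ∃ k, n = 4 * k + 3 := ⟨n / 4, by lia⟩
    have : (4 * k + 3) * (4 * k + 3 - 1) / 2 = (4 * k + 3) * (2 * k + 1) :=
      Nat.div_eq_of_eq_mul_right two_pos (by rw [Nat.add_sub_assoc (by lia)]; ring)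
    rw [this]
    exact Odd.mul ⟨2 * k + 1, by ring⟩ ⟨k, rfl⟩
  have hnonneg := (isSquare_of_isSquare_discr (by lia) hL hsq).nonneg
  rw [hsign.neg_one_pow, neg_one_mul, neg_mul, Int.neg_nonneg] at hnonneg
  have hn0 : 0 < n := by lia
  exact hnonneg.not_gt (by positivity)

theorem not_isSquare_discr_of_jacobiSym_eq_neg_one (hℓ : ℓ.Prime) (hn : n % 4 = 1) (hle : ℓ ≤ n)
    (hlt : n < 2 * ℓ) (hJ : J(n | ℓ) = -1) : ¬ IsSquare (truncatedLogPoly n).discr := by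
  intro hsq
  have : Fact ℓ.Prime := ⟨hℓ⟩
  obtain ⟨u, hu, hL⟩ := exists_not_dvd_forall_dvd_pow_mul (m := 1) (n := n) hℓ
    (by rw [one_add_one_eq_two]; nlinarith [hℓ.two_le])
  have hu0 : u ≠ 0 := fun h ↦ hu (h ▸ dvd_zero ℓ)
  have h := isSquare_mul_scaledLogResultant hn hL (mul_ne_zero (pow_ne_zero _ hℓ.ne_zero) hu0) hsq
    (ZMod ℓ)
  have heven : Even (n - 1) := (Nat.even_iff.2 (by lia))
  rw [scaledLogResultant_of_leading_digit_one hℓ one_ne_zero (by lia) (by lia) hL,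
    (heven.mul_right _).neg_one_pow, one_mul] at h
  have huℓ : (u : ZMod ℓ) ≠ 0 := by rwa [ne_eq, ZMod.natCast_eq_zero_iff]
  refine ZMod.nonsquare_of_jacobiSym_eq_neg_one hJ ?_
  simpa [pow_ne_zero _ huℓ] using h.div (heven.isSquare_pow (u : ZMod ℓ))

theorem not_isSquare_discr_of_isPrimitiveRoot {g : ℕ} (hℓ : ℓ.Prime) (hn : n % 4 = 1)
    (hg : IsPrimitiveRoot (g : ZMod ℓ) n)
    (hns : ¬ IsSquare ((n * ∏ i ∈ range (n - 1),
      (n ! + ∑ k ∈ Icc 1 n, n ! / k * (g ^ (i + 1)) ^ k) : ℕ) : ZMod ℓ)) :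
    ¬ IsSquare (truncatedLogPoly n).discr := by
  have : Fact ℓ.Prime := ⟨hℓ⟩
  intro hsq
  have hL : ∀ k ∈ Icc 1 n, k ∣ n ! := fun k hk ↦
    Nat.dvd_factorial (mem_Icc.1 hk).1 (mem_Icc.1 hk).2
  have h := isSquare_mul_scaledLogResultant hn hL n.factorial_ne_zero hsq (ZMod ℓ)
  obtain ⟨k, rfl⟩ : ∃ k, n = k + 1 := ⟨n - 1, by lia⟩
  rw [scaledLogResultant, Nat.add_sub_cancel, resultant_geom_sum_X_eq_prod hg
    (natDegree_C_add_scaledLogSum_le _ _ _ _),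
    ((Nat.even_iff.2 (by lia : k % 2 = 0)).mul_left _).neg_one_pow, one_mul] at h
  refine hns ?_
  simpa [eval_scaledLogSum] using h

lemma not_isSquare_discr_prime_mul_self {p g : ℕ} (hp : p.Prime) (hp2 : p ≠ 2) (hℓ : ℓ.Prime)
    (hg1 : (g : ZMod ℓ) ^ p ≠ 1) (hg : (g : ZMod ℓ) ^ (p * p) = 1)
    (hns : ¬ IsSquare ((p * p * ∏ i ∈ range (p * p - 1), ((p * p) ! +
      ∑ k ∈ Icc 1 (p * p), (p * p) ! / k * (g ^ (i + 1)) ^ k) : ℕ) : ZMod ℓ)) :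
    ¬ IsSquare (truncatedLogPoly (p * p)).discr := by
  have : Fact p.Prime := ⟨hp⟩
  have hn : p * p % 4 = 1 := by
    rcases Nat.odd_mod_four_iff.1 (Nat.odd_iff.1 (hp.odd_of_ne_two hp2)) with h | h <;>
      simp [Nat.mul_mod, h]
  refine not_isSquare_discr_of_isPrimitiveRoot hℓ hn (IsPrimitiveRoot.iff_orderOf.2 ?_) hns
  rw [← sq] at hg ⊢
  exact orderOf_eq_prime_pow (n := 1) (by rwa [pow_one]) hg

theorem exists_root_of_isSquare_discr_mul {p q M : ℕ} [Fact q.Prime] (K : Type*) [Field K]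
    [IsAlgClosed K] [CharP K q] (hpq : p < q) (hodd : Odd (p * q)) (hM : ∀ k ∈ Icc 1 p, k ∣ M)
    (hsq : IsSquare (truncatedLogPoly (p * q)).discr) :
    ∃ w : K, w ^ p = 1 ∧ (scaledLogSum K M p).eval w = 0 := by
  have hq : q.Prime := Fact.out
  have hp : 0 < p := (Nat.odd_mul.1 hodd).1.pos
  obtain ⟨u, hu, hL⟩ := exists_not_dvd_forall_dvd_pow_mul (m := 1) (n := p * q) hq
    (by rw [one_add_one_eq_two]; nlinarith [hq.pos])
  have hval : padicValNat q (p * q) = 1 := by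
    rw [padicValNat.mul hp.ne' hq.ne_zero, padicValNat_self,
      padicValNat.eq_zero_of_not_dvd (Nat.not_dvd_of_pos_of_lt hp hpq)]
  have hzero : scaledLogResultant (ZMod q) (q ^ 1 * u) (p * q) = 0 := by
    by_contra hne
    refine not_isSquare_discr_of_odd_valuation hu hL hne ?_ hsq
    rwa [hval, one_mul, Nat.sub_add_cancel hodd.pos]
  have hzeroK : scaledLogResultant K (q ^ 1 * u) (p * q) = 0 := by
    rw [← map_scaledLogResultant _ _ _ (ZMod.castHom dvd_rfl K), hzero, map_zero]
  obtain ⟨w, hw, heval⟩ := exists_root_of_scaledLogResultant_mul_eq_zero hq hodd.pos.ne' hL hzeroK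
  have hdvd : ∀ k ∈ Icc 1 p, k ∣ u := fun k hk ↦ by
    obtain ⟨hk1, hkp⟩ := mem_Icc.1 hk
    refine Nat.dvd_of_mul_dvd_mul_left hq.pos ?_
    simpa [mul_comm p] using hL (q * k) (mem_Icc.2
      ⟨Nat.mul_pos hq.pos hk1, by rw [mul_comm p]; exact Nat.mul_le_mul_left q hkp⟩)
  have hcomm := congrArg (eval w) (C_mul_scaledLogSum_comm (R := K) hdvd hM)
  rw [eval_C_mul, eval_C_mul, heval, mul_zero, mul_eq_zero, CharP.cast_eq_zero_iff K q] at hcomm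
  exact ⟨w, hw, hcomm.resolve_left hu⟩

end Criteria

section SmallFactors

variable {K : Type*} [CommRing K] [IsDomain K]

lemma eq_one_or_geom_sum_eq_zero {n : ℕ} {w : K} (hw : w ^ n = 1) :
    w = 1 ∨ ∑ i ∈ range n, w ^ i = 0 := by
  have h := geom_sum_mul w n
  rw [hw, sub_self, mul_eq_zero, sub_eq_zero] at h
  exact h.symm

lemma dvd_of_eval_scaledLogSum_three_eq_zero (q : ℕ) [CharP K q] {w : K} (hw : w ^ 3 = 1)
    (h : (scaledLogSum K 6 3).eval w = 0) : q ∣ 11 ∨ q ∣ 13 := by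
  simp only [← CharP.cast_eq_zero_iff K q]
  have hsum : 6 * w + 3 * w ^ 2 + 2 * w ^ 3 = 0 := by
    simpa [eval_scaledLogSum, sum_Icc_succ_top] using h
  rcases eq_one_or_geom_sum_eq_zero hw with rfl | hΦ
  · left
    linear_combination hsum
  · right
    simp only [sum_range_succ, sum_range_zero] at hΦ
    linear_combination (-4 - 3 * w) * hsum + (13 + 11 * w + 6 * w ^ 2) * hΦ

lemma dvd_of_eval_scaledLogSum_five_eq_zero (q : ℕ) [CharP K q] {w : K} (hw : w ^ 5 = 1)
    (h : (scaledLogSum K 60 5).eval w = 0) : q ∣ 137 ∨ q ∣ 11 * 101 * 3001 := by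
  simp only [← CharP.cast_eq_zero_iff K q]
  have hsum : 60 * w + 30 * w ^ 2 + 20 * w ^ 3 + 15 * w ^ 4 + 12 * w ^ 5 = 0 := by
    simpa [eval_scaledLogSum, sum_Icc_succ_top] using h
  rcases eq_one_or_geom_sum_eq_zero hw with rfl | hΦ
  · left
    linear_combination hsum
  · right
    simp only [sum_range_succ, sum_range_zero] at hΦ
    linear_combination (-94962 - 70605 * w - 68110 * w ^ 2 - 67170 * w ^ 3) * hsum +
      (3334111 + 2363609 * w + 1387440 * w ^ 2 + 1018830 * w ^ 3 + 806040 * w ^ 4) * hΦ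

/-- The Bézout constant `1170728665999621` is displayed as a sum of two coprime squares to exhibit
that its odd prime factors are `1` modulo `4`. -/
lemma dvd_of_eval_scaledLogSum_seven_eq_zero (q : ℕ) [CharP K q] {w : K} (hw : w ^ 7 = 1)
    (h : (scaledLogSum K 420 7).eval w = 0) :
    q ∣ (3 * 11) ^ 2 ∨ q ∣ 27637650 ^ 2 + 20171489 ^ 2 := by
  simp only [← CharP.cast_eq_zero_iff K q]
  have hsum : 420 * w + 210 * w ^ 2 + 140 * w ^ 3 + 105 * w ^ 4 + 84 * w ^ 5 +
      70 * w ^ 6 + 60 * w ^ 7 = 0 := by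
    simpa [eval_scaledLogSum, sum_Icc_succ_top] using h
  rcases eq_one_or_geom_sum_eq_zero hw with rfl | hΦ
  · left
    linear_combination hsum
  · right
    simp only [sum_range_succ, sum_range_zero] at hΦ
    linear_combination
      (-4595165710280 - 3394818242970 * w - 3274653377996 * w ^ 2 - 3230414003635 * w ^ 3 -
        3207987293700 * w ^ 4 - 3194563008910 * w ^ 5) * hsum +
      (1170728665999621 + 759240932317979 * w + 460838862888600 * w ^ 2 +
        340780988015020 * w ^ 3 + 270628595279840 * w ^ 4 + 224424867711100 * w ^ 5 +
        191673780534600 * w ^ 6) * hΦ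

end SmallFactors

section Families

lemma not_isSquare_discr_nine : ¬ IsSquare (truncatedLogPoly (3 * 3)).discr :=
  not_isSquare_discr_prime_mul_self (ℓ := 73) (g := 2) (by norm_num) (by norm_num) (by norm_num)
    (by decide +kernel) (by decide +kernel) (by decide +kernel)

lemma not_isSquare_discr_twentyFive : ¬ IsSquare (truncatedLogPoly (5 * 5)).discr :=
  not_isSquare_discr_prime_mul_self (ℓ := 151) (g := 9) (by norm_num) (by norm_num) (by norm_num)
    (by decide +kernel) (by decide +kernel) (by decide +kernel)

lemma not_isSquare_discr_fortyNine : ¬ IsSquare (truncatedLogPoly (7 * 7)).discr :=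
  not_isSquare_discr_prime_mul_self (ℓ := 197) (g := 16) (by norm_num) (by norm_num) (by norm_num)
    (by decide +kernel) (by decide +kernel) (by decide +kernel)

lemma mod_four_eq_one_of_dvd_sq_add_sq {q a b : ℕ} (hq : q.Prime) (hodd : Odd q)
    (hab : a.Coprime b) (h : q ∣ a ^ 2 + b ^ 2) : q % 4 = 1 := by
  have : Fact q.Prime := ⟨hq⟩
  have hsq : IsSquare (-1 : ZMod q) := ZMod.isSquare_neg_one_of_dvd h
    (ZMod.isSquare_neg_one_of_eq_sq_add_sq_of_coprime rfl hab)
  exact (Nat.odd_mod_four_iff.1 (Nat.odd_iff.1 hodd)).resolve_right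
    (ZMod.exists_sq_eq_neg_one_iff.1 hsq)

variable {q : ℕ}

theorem not_isSquare_discr_three_mul (hq : q.Prime) :
    ¬ IsSquare (truncatedLogPoly (3 * q)).discr := by
  have : Fact q.Prime := ⟨hq⟩
  rcases hq.eq_two_or_odd' with rfl | hodd
  · exact not_isSquare_discr_of_even (by decide) (by norm_num)
  have h1 : 1 < q := hq.one_lt
  obtain rfl | hlt : q = 3 ∨ 3 < q := by grind
  · exact not_isSquare_discr_nine
  intro hsq
  obtain ⟨w, hw, heval⟩ := exists_root_of_isSquare_discr_mul (AlgebraicClosure (ZMod q)) hlt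
    (Odd.mul (by decide) hodd) (M := 6) (by decide) hsq
  rcases dvd_of_eval_scaledLogSum_three_eq_zero q hw heval with h | h
  · obtain rfl : q = 11 := (Nat.prime_dvd_prime_iff_eq hq (by norm_num)).1 h
    exact not_isSquare_discr_of_jacobiSym_eq_neg_one (ℓ := 19) (by norm_num) (by norm_num)
      (by norm_num) (by norm_num) (by norm_num) hsq
  · obtain rfl : q = 13 := (Nat.prime_dvd_prime_iff_eq hq (by norm_num)).1 h
    exact not_isSquare_discr_of_mod_four_eq_three (by norm_num) hsq

theorem not_isSquare_discr_five_mul (hq : q.Prime) :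
    ¬ IsSquare (truncatedLogPoly (5 * q)).discr := by
  have : Fact q.Prime := ⟨hq⟩
  rcases hq.eq_two_or_odd' with rfl | hodd
  · exact not_isSquare_discr_of_even (by decide) (by norm_num)
  have h1 : 1 < q := hq.one_lt
  obtain rfl | rfl | hlt : q = 3 ∨ q = 5 ∨ 5 < q := by grind
  · exact not_isSquare_discr_of_mod_four_eq_three (by norm_num)
  · exact not_isSquare_discr_twentyFive
  intro hsq
  obtain ⟨w, hw, heval⟩ := exists_root_of_isSquare_discr_mul (AlgebraicClosure (ZMod q)) hlt
    (Odd.mul (by decide) hodd) (M := 60) (by decide) hsq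
  have hdvd := dvd_of_eval_scaledLogSum_five_eq_zero q hw heval
  rw [hq.dvd_mul, hq.dvd_mul, Nat.prime_dvd_prime_iff_eq hq (by norm_num),
    Nat.prime_dvd_prime_iff_eq hq (by norm_num), Nat.prime_dvd_prime_iff_eq hq (by norm_num),
    Nat.prime_dvd_prime_iff_eq hq (by norm_num)] at hdvd
  rcases hdvd with rfl | (rfl | rfl) | rfl
  · exact not_isSquare_discr_of_jacobiSym_eq_neg_one (ℓ := 347) (by norm_num) (by norm_num)
      (by norm_num) (by norm_num) (by norm_num) hsq
  · exact not_isSquare_discr_of_mod_four_eq_three (by norm_num) hsq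
  · exact not_isSquare_discr_of_jacobiSym_eq_neg_one (ℓ := 269) (by norm_num) (by norm_num)
      (by norm_num) (by norm_num) (by norm_num) hsq
  · exact not_isSquare_discr_of_jacobiSym_eq_neg_one (ℓ := 7507) (by norm_num) (by norm_num)
      (by norm_num) (by norm_num) (by norm_num) hsq

theorem not_isSquare_discr_seven_mul (hq : q.Prime) :
    ¬ IsSquare (truncatedLogPoly (7 * q)).discr := by
  have : Fact q.Prime := ⟨hq⟩
  rcases hq.eq_two_or_odd' with rfl | hodd
  · exact not_isSquare_discr_of_even (by decide) (by norm_num)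
  have h1 : 1 < q := hq.one_lt
  obtain rfl | rfl | rfl | hlt : q = 3 ∨ q = 5 ∨ q = 7 ∨ 7 < q := by grind
  · exact not_isSquare_discr_three_mul (q := 7) (by norm_num)
  · exact not_isSquare_discr_of_mod_four_eq_three (by norm_num)
  · exact not_isSquare_discr_fortyNine
  intro hsq
  obtain ⟨w, hw, heval⟩ := exists_root_of_isSquare_discr_mul (AlgebraicClosure (ZMod q)) hlt
    (Odd.mul (by decide) hodd) (M := 420) (by decide) hsq
  rcases dvd_of_eval_scaledLogSum_seven_eq_zero q hw heval with h | h
  · rw [hq.prime.dvd_pow_iff_dvd two_ne_zero, hq.dvd_mul,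
      Nat.prime_dvd_prime_iff_eq hq (by norm_num), Nat.prime_dvd_prime_iff_eq hq (by norm_num)] at h
    obtain rfl : q = 11 := h.resolve_left (by lia)
    exact not_isSquare_discr_of_jacobiSym_eq_neg_one (ℓ := 43) (by norm_num) (by norm_num)
      (by norm_num) (by norm_num) (by norm_num) hsq
  · have hmod := mod_four_eq_one_of_dvd_sq_add_sq hq hodd (by norm_num) h
    exact not_isSquare_discr_of_mod_four_eq_three (by lia) hsq

end Families

theorem proposition5p1 (q n : ℕ) (hq : q.Prime) (hn : n = 3 * q ∨ n = 5 * q ∨ n = 7 * q) :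
    ¬ IsSquare (truncatedLogPoly n).discr := by
  rcases hn with rfl | rfl | rfl
  · exact not_isSquare_discr_three_mul hq
  · exact not_isSquare_discr_five_mul hq
  · exact not_isSquare_discr_seven_mul hq
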